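/- Let $M$ be a finite-dimensional paracompact Hausdorff $C^\infty$ manifold and let $L$ be a smooth vector $1$-form on $M$ (a smooth field of endomorphisms $L_z$ of $T_zM$) of constant rank $m\ge 1$, with vanishing Nijenhuis tensor $N_L=\frac12[L,L]$, where $N_L(X,Y)=[LX,LY]+L^2[X,Y]-L[LX,Y]-L[X,LY]$, and with $\operatorname{Im}L_z=\operatorname{Ker}L_z$ for all $z\in M$ (so $\dim M=2m$). Let $C$ be a canonical vector field of $(M,L)$, that is, a smooth vector field on $M$ such that $M$ is covered by the domains of smooth coordinate systems $(x^1,\dots,x^m;y^1,\dots,y^m)$ in which $$L\Big(\frac{\partial}{\partial x^i}\Big)=\frac{\partial}{\partial y^i},\qquad L\Big(\frac{\partial}{\partial y^i}\Big)=0,\qquad C=\sum_i y^i\frac{\partial}{\partial y^i}.$$ For a vector field $X$ and a vector $1$-form $K$, the Frölicher–Nijenhuis brackets $[K,X]$ and $[X,K]=-[K,X]$ are the vector $1$-forms with $[K,X]Y=[KY,X]-K[Y,X]$ for all vector fields $Y$. All objects are smooth. An $L$-semispray is a vector field $S$ with $LS=C$; it is an $L$-spray if moreover $[C,S]=S$.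 An $L$-connection is a vector $1$-form $\Gamma$ with $L\Gamma=L$ and $\Gamma L=-L$; it is homogeneous if moreover $[C,\Gamma]=0$. The canonical $L$-semispray of an $L$-connection $\Gamma$ (called its canonical $L$-spray if it is an $L$-spray) is the $L$-semispray $S$ such that, for every $L$-semispray $S'$, $S=hS'$, where $h=\frac12(I+\Gamma)$, and $\frac12[C,\Gamma]S'+S-[C,S]=0$. (a) If $S$ is an $L$-semispray on $M$, then $[L,S]$ is an $L$-connection on $M$, and its canonical $L$-semispray exists, is unique, and is $\frac12(S+[C,S])$. (b) If $S$ is an $L$-spray on $M$, then $[L,S]$ is a homogeneous $L$-connection on $M$, and its canonical $L$-spray exists, is unique, and is $S$ itself. -/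

import Mathlib

open scoped Manifold ContDiff Bundle Topology
open VectorField

noncomputable section

namespace LConn

/-- The module `𝔛(M)` of smooth vector fields on `M`. -/
abbrev VField (E : Type*) [NormedAddCommGroup E] [NormedSpace ℝ E]
    (M : Type*) [TopologicalSpace M] [ChartedSpace E M] [IsManifold 𝓘(ℝ, E) ∞ M] :=
  Cₛ^∞⟮𝓘(ℝ, E); E, (TangentSpace 𝓘(ℝ, E) : M → Type _)⟯

/-- The module `Ψ¹(M)` of smooth vector `1`-forms on `M`, that is, of smooth fields of
endomorphisms of the tangent spaces. -/
abbrev VForm (E : Type*) [NormedAddCommGroup E] [NormedSpace ℝ E]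
    (M : Type*) [TopologicalSpace M] [ChartedSpace E M] [IsManifold 𝓘(ℝ, E) ∞ M] :=
  Cₛ^∞⟮𝓘(ℝ, E); E →L[ℝ] E,
    (fun z : M ↦ TangentSpace 𝓘(ℝ, E) z →L[ℝ] TangentSpace 𝓘(ℝ, E) z)⟯

variable {E : Type*} [NormedAddCommGroup E] [NormedSpace ℝ E]
  {M : Type*} [TopologicalSpace M] [ChartedSpace E M] [IsManifold 𝓘(ℝ, E) ∞ M]

/-- The vector field `K X`, for a vector `1`-form `K` and a vector field `X`. -/
def VForm.app (K : VForm E M) (X : VField E M) : VField E M :=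
  ⟨fun z ↦ K z (X z), K.contMDiff.clm_bundle_apply X.contMDiff⟩

variable [FiniteDimensional ℝ E]

theorem contMDiffAt_mlieBracket {X Y : Π z : M, TangentSpace 𝓘(ℝ, E) z} {z : M}
    (hX : ContMDiffAt 𝓘(ℝ, E) 𝓘(ℝ, E).tangent ∞
      (fun x ↦ (⟨x, X x⟩ : TangentBundle 𝓘(ℝ, E) M)) z)
    (hY : ContMDiffAt 𝓘(ℝ, E) 𝓘(ℝ, E).tangent ∞
      (fun x ↦ (⟨x, Y x⟩ : TangentBundle 𝓘(ℝ, E) M)) z) :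
    ContMDiffAt 𝓘(ℝ, E) 𝓘(ℝ, E).tangent ∞
      (fun x ↦ (⟨x, mlieBracket 𝓘(ℝ, E) X Y x⟩ : TangentBundle 𝓘(ℝ, E) M)) z := by
  have : CompleteSpace E := FiniteDimensional.complete ℝ E
  have : IsManifold 𝓘(ℝ, E) (minSmoothness ℝ 2) M := by
    rw [minSmoothness_of_isRCLikeNormedField]; infer_instance
  have : IsManifold 𝓘(ℝ, E) (((⊤ : ℕ∞) : WithTop ℕ∞) + 1) M :=
    inferInstanceAs (IsManifold 𝓘(ℝ, E) ∞ M)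
  refine ContMDiffAt.mlieBracket_vectorField (n := ⊤) (m := ⊤) hX hY ?_
  rw [minSmoothness_of_isRCLikeNormedField]
  exact le_rfl

/-- The Lie bracket of two smooth vector fields. -/
def bracket (X Y : VField E M) : VField E M :=
  ⟨mlieBracket 𝓘(ℝ, E) X Y, fun z ↦ contMDiffAt_mlieBracket (X.contMDiff z) (Y.contMDiff z)⟩

/-- The expression `Y ↦ ([K Y, X] - K [Y, X])(z)`, for locally defined `Y`. -/
def preBracket (K : VForm E M) (X : VField E M) (z : M) (Y : Π x : M, TangentSpace 𝓘(ℝ, E) x) :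
    TangentSpace 𝓘(ℝ, E) z :=
  mlieBracket 𝓘(ℝ, E) (fun x ↦ K x (Y x)) X z - K z (mlieBracket 𝓘(ℝ, E) Y X z)

theorem tensorialAt_preBracket (K : VForm E M) (X : VField E M) (z : M) :
    TensorialAt 𝓘(ℝ, E) E (preBracket K X z) z := by
  have : CompleteSpace E := FiniteDimensional.complete ℝ E
  have hK := (K.contMDiff z).mdifferentiableAt (by simp)
  constructor
  · intro f Y hf hY
    have hKY := hK.clm_bundle_apply hY
    have h1 : (fun x ↦ K x ((f • Y) x)) = f • (fun x ↦ K x (Y x)) := by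
      funext x
      exact (K x).map_smul (f x) (Y x)
    simp only [preBracket]
    rw [h1, mlieBracket_smul_left hf hKY, mlieBracket_smul_left hf hY, map_add, map_smul,
      map_smul, smul_sub]
    abel
  · intro Y Y' hY hY'
    have hKY := hK.clm_bundle_apply hY
    have hKY' := hK.clm_bundle_apply hY'
    have h1 : (fun x ↦ K x ((Y + Y') x)) = (fun x ↦ K x (Y x)) + (fun x ↦ K x (Y' x)) := by
      funext x
      exact (K x).map_add (Y x) (Y' x)
    simp only [preBracket]
    rw [h1, mlieBracket_add_left hKY hKY', mlieBracket_add_left hY hY', map_add]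
    abel

theorem contMDiffAt_of_frame (φ : Π z : M, TangentSpace 𝓘(ℝ, E) z →L[ℝ] TangentSpace 𝓘(ℝ, E) z)
    (z : M)
    (h : ∀ Y : Π x : M, TangentSpace 𝓘(ℝ, E) x,
      (∀ᶠ y in 𝓝 z, ContMDiffAt 𝓘(ℝ, E) 𝓘(ℝ, E).tangent ∞
        (fun x ↦ (⟨x, Y x⟩ : TangentBundle 𝓘(ℝ, E) M)) y) →
      ContMDiffAt 𝓘(ℝ, E) 𝓘(ℝ, E).tangent ∞
        (fun x ↦ (⟨x, φ x (Y x)⟩ : TangentBundle 𝓘(ℝ, E) M)) z) :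
    ContMDiffAt 𝓘(ℝ, E) (𝓘(ℝ, E).prod 𝓘(ℝ, E →L[ℝ] E)) ∞
      (fun x ↦ Bundle.TotalSpace.mk' (E →L[ℝ] E)
        (E := fun x : M ↦ TangentSpace 𝓘(ℝ, E) x →L[ℝ] TangentSpace 𝓘(ℝ, E) x) x (φ x)) z := by
  rw [contMDiffAt_hom_bundle]
  refine ⟨contMDiffAt_id, ?_⟩
  let b := Module.finBasis ℝ E
  let e := trivializationAt E (TangentSpace 𝓘(ℝ, E) : M → Type _) z
  have hz : z ∈ e.baseSet := FiberBundle.mem_baseSet_trivializationAt E _ z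
  let c (i) : E →L[ℝ] E →L[ℝ] E :=
    ContinuousLinearMap.smulRightL ℝ E E (LinearMap.toContinuousLinearMap (b.coord i))
  have key (i) : ContMDiffAt 𝓘(ℝ, E) 𝓘(ℝ, E) ∞
      (fun x ↦ (e (⟨x, φ x (e.localFrame b i x)⟩ : TangentBundle 𝓘(ℝ, E) M)).2) z := by
    have hf := h (e.localFrame b i) (by
      filter_upwards [e.open_baseSet.mem_nhds hz] with y hy
      exact contMDiffAt_localFrame_of_mem ∞ e b i hy)
    exact (Bundle.contMDiffAt_totalSpace.1 hf).2
  have key2 : ContMDiffAt 𝓘(ℝ, E) 𝓘(ℝ, E →L[ℝ] E) ∞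
      (fun x ↦ ∑ i, c i ((e (⟨x, φ x (e.localFrame b i x)⟩ : TangentBundle 𝓘(ℝ, E) M)).2)) z := by
    refine ContMDiffAt.sum fun i _ ↦ ?_
    exact (c i).contMDiff.contMDiffAt.comp z (key i)
  refine key2.congr_of_eventuallyEq ?_
  filter_upwards [e.open_baseSet.mem_nhds hz] with x hx
  refine ContinuousLinearMap.coe_injective (b.ext fun j ↦ ?_)
  rw [ContinuousLinearMap.coe_coe, ContinuousLinearMap.inCoordinates_eq hx hx]
  simp [c, e.localFrame_apply_of_mem_baseSet b hx, Bundle.Trivialization.basisAt,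
    Finsupp.single_apply]
  rfl

/-- The Frölicher-Nijenhuis bracket `[K, X]` of a vector `1`-form `K` and a vector field `X`:
the vector `1`-form with `[K, X] Y = [K Y, X] - K [Y, X]` for every vector field `Y`
(see `fnBracket_app`). -/
def fnBracket (K : VForm E M) (X : VField E M) : VForm E M :=
  ⟨fun z ↦ TensorialAt.mkHom (preBracket K X z) z (tensorialAt_preBracket K X z), by
    intro z
    refine contMDiffAt_of_frame _ z fun Y hY ↦ ?_
    have hKY : ∀ᶠ y in 𝓝 z, ContMDiffAt 𝓘(ℝ, E) 𝓘(ℝ, E).tangent ∞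
        (fun x ↦ (⟨x, K x (Y x)⟩ : TangentBundle 𝓘(ℝ, E) M)) y := by
      filter_upwards [hY] with y hy
      exact (K.contMDiff y).clm_bundle_apply hy
    have h1 := contMDiffAt_mlieBracket hKY.self_of_nhds (X.contMDiff z)
    have h2 := (K.contMDiff z).clm_bundle_apply
      (contMDiffAt_mlieBracket hY.self_of_nhds (X.contMDiff z))
    refine (h1.sub_section h2).congr_of_eventuallyEq ?_
    filter_upwards [hY] with y hy
    congr 1
    exact TensorialAt.mkHom_apply (tensorialAt_preBracket K X y)
      (hy.mdifferentiableAt (by simp))⟩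

theorem fnBracket_app (K : VForm E M) (X Y : VField E M) :
    (fnBracket K X).app Y = bracket (K.app Y) X - K.app (bracket Y X) := by
  ext z
  exact TensorialAt.mkHom_apply (tensorialAt_preBracket K X z)
    ((Y.contMDiff z).mdifferentiableAt (by simp))

/-- The Frölicher-Nijenhuis bracket `[X, K] = -[K, X]` of a vector field and a vector `1`-form:
`[X, K] Y = [X, K Y] - K [X, Y]` for every vector field `Y`. -/
def fieldFormBracket (X : VField E M) (K : VForm E M) : VForm E M :=
  -fnBracket K X

theorem fieldFormBracket_app (X : VField E M) (K : VForm E M) (Y : VField E M) :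
    (fieldFormBracket X K).app Y = bracket X (K.app Y) - K.app (bracket X Y) := by
  ext z
  have h := congrArg (fun Z : VField E M ↦ Z z) (fnBracket_app K X Y)
  have h1 : mlieBracket 𝓘(ℝ, E) X (K.app Y) z = -mlieBracket 𝓘(ℝ, E) (K.app Y) X z :=
    mlieBracket_swap_apply
  have h2 : mlieBracket 𝓘(ℝ, E) X Y z = -mlieBracket 𝓘(ℝ, E) Y X z := mlieBracket_swap_apply
  change fnBracket K X z (Y z) =
    mlieBracket 𝓘(ℝ, E) (K.app Y) X z - K z (mlieBracket 𝓘(ℝ, E) Y X z) at h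
  change -(fnBracket K X z (Y z)) =
    mlieBracket 𝓘(ℝ, E) X (K.app Y) z - K z (mlieBracket 𝓘(ℝ, E) X Y z)
  rw [h, h1, h2, map_neg]
  abel

/-- The Nijenhuis tensor `N_L = ½ [L, L]` of a vector `1`-form, evaluated on two vector fields. -/
def nijenhuis (L : VForm E M) (X Y : VField E M) : VField E M :=
  bracket (L.app X) (L.app Y) + L.app (L.app (bracket X Y))
    - L.app (bracket (L.app X) Y) - L.app (bracket X (L.app Y))

/-- The coordinate vector field `∂/∂xⁱ` of a coordinate system `e = (x¹, …, xᵐ; y¹, …, yᵐ)`. -/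
def coordX {m : ℕ} (e : OpenPartialHomeomorph M ((Fin m → ℝ) × (Fin m → ℝ))) (i : Fin m) (p : M) :
    TangentSpace 𝓘(ℝ, E) p :=
  mpullback 𝓘(ℝ, E) 𝓘(ℝ, (Fin m → ℝ) × (Fin m → ℝ)) e
    (fun _ ↦ ((Pi.single i 1, 0) : (Fin m → ℝ) × (Fin m → ℝ))) p

/-- The coordinate vector field `∂/∂yⁱ` of a coordinate system `e = (x¹, …, xᵐ; y¹, …, yᵐ)`. -/
def coordY {m : ℕ} (e : OpenPartialHomeomorph M ((Fin m → ℝ) × (Fin m → ℝ))) (i : Fin m) (p : M) :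
    TangentSpace 𝓘(ℝ, E) p :=
  mpullback 𝓘(ℝ, E) 𝓘(ℝ, (Fin m → ℝ) × (Fin m → ℝ)) e
    (fun _ ↦ ((0, Pi.single i 1) : (Fin m → ℝ) × (Fin m → ℝ))) p

/-- `C` is a canonical vector field for `L`: `M` is covered by the domains of smooth coordinate
systems `(x¹, …, xᵐ; y¹, …, yᵐ)` in which `L (∂/∂xⁱ) = ∂/∂yⁱ`, `L (∂/∂yⁱ) = 0` and
`C = ∑ yⁱ ∂/∂yⁱ`. -/
def IsCanonicalField (m : ℕ) (L : VForm E M) (C : VField E M) : Prop :=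
  ∀ z : M, ∃ e : OpenPartialHomeomorph M ((Fin m → ℝ) × (Fin m → ℝ)),
    z ∈ e.source ∧
    ContMDiffOn 𝓘(ℝ, E) 𝓘(ℝ, (Fin m → ℝ) × (Fin m → ℝ)) ∞ e e.source ∧
    ContMDiffOn 𝓘(ℝ, (Fin m → ℝ) × (Fin m → ℝ)) 𝓘(ℝ, E) ∞ e.symm e.target ∧
    ∀ p ∈ e.source,
      (∀ i, L p (coordX e i p) = coordY e i p) ∧
      (∀ i, L p (coordY e i p) = 0) ∧
      C p = ∑ i, (e p).2 i • coordY e i p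

/-- A vector field `X` is homogeneous of degree `r`: `[C, X] = (r - 1) X`. -/
def IsHomogeneousField (C : VField E M) (r : ℝ) (X : VField E M) : Prop :=
  bracket C X = (r - 1) • X

/-- A vector `1`-form `K` is homogeneous of degree `r`: `[C, K] = (r - 1) K`. -/
def IsHomogeneousForm (C : VField E M) (r : ℝ) (K : VForm E M) : Prop :=
  fieldFormBracket C K = (r - 1) • K

/-- `S` is an `L`-semispray: `L S = C`. -/
def IsSemispray (L : VForm E M) (C S : VField E M) : Prop :=
  L.app S = C

/-- `S` is an `L`-spray: an `L`-semispray that is homogeneous of degree `2`. -/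
def IsSpray (L : VForm E M) (C S : VField E M) : Prop :=
  IsSemispray L C S ∧ IsHomogeneousField C 2 S

/-- `Γ` is an `L`-connection: `L Γ = L` and `Γ L = -L`. -/
def IsConnection (L Γ : VForm E M) : Prop :=
  (∀ z, (L z).comp (Γ z) = L z) ∧ (∀ z, (Γ z).comp (L z) = -L z)

/-- `Γ` is a homogeneous `L`-connection: an `L`-connection that is homogeneous of degree `1`. -/
def IsHomogeneousConnection (L : VForm E M) (C : VField E M) (Γ : VForm E M) : Prop :=
  IsConnection L Γ ∧ IsHomogeneousForm C 1 Γ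

/-- The horizontal projector `h = ½ (I + Γ)` applied to a vector field. -/
def horizontal (Γ : VForm E M) (X : VField E M) : VField E M :=
  (1 / 2 : ℝ) • (X + Γ.app X)

/-- `S` is the canonical `L`-semispray of `Γ`: the `L`-semispray with `S = h S'` for an arbitrary
`L`-semispray `S'`, which also has to satisfy `½ [C, Γ]° + S - [C, S] = 0`; here the potential
`[C, Γ]° = [C, Γ] S'` is formed with an arbitrary `L`-semispray `S'`. -/
def IsCanonicalSemispray (L : VForm E M) (C : VField E M) (Γ : VForm E M) (S : VField E M) : Prop :=
  IsSemispray L C S ∧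
  ∀ S' : VField E M, IsSemispray L C S' →
    S = horizontal Γ S' ∧
    (1 / 2 : ℝ) • (fieldFormBracket C Γ).app S' + S - bracket C S = 0

end LConn

end

/-! The coordinates of `C` enter only through `[L, C] = L` (`IsCanonicalField.fnBracket_eq`); the
rest is algebra of brackets. Put `Γ = [L, S]` with `L S = C`. The vanishing of `N_L(X, S)`, with `L²
= 0` and `[L, C] = L`, gives `L [L X, S] = L X`, from which both connection identities follow.

Any connection is `-1` on `Im L = Ker L`, and two semisprays differ by a section of `Ker L`. Since
`Γ S = [C, S]`, this fixes `Γ` on every semispray: `Γ S' = [C, S] - (S' - S)`. So `h S' = ½ (S + [C,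
S])` for all `S'`, which is the only candidate, and the potential equation becomes a direct
computation.

For a spray, `[C, S] = S` reduces the candidate to `S`, and homogeneity of `Γ` is the Jacobi
identity combined with `[C, L] = -L`. -/

noncomputable section

namespace LConn

/-! ### Global vector fields separate vector 1-forms. -/

section Extension

variable {E : Type*} [NormedAddCommGroup E] [NormedSpace ℝ E] [FiniteDimensional ℝ E]
  {M : Type*} [TopologicalSpace M] [ChartedSpace E M] [IsManifold 𝓘(ℝ, E) ∞ M] [T2Space M]

/-- Every tangent vector is the value of a globally defined smooth vector field. -/
theorem exists_vfield_eq (z : M) (w : TangentSpace 𝓘(ℝ, E) z) :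
    ∃ X : VField E M, X z = w := by
  obtain ⟨s, hs, hsw⟩ := FiberBundle.exists_contMDiffOn_extend (k := ∞) 𝓘(ℝ, E) E w
  -- A bump function supported where the local extension is smooth, and equal to 1 at `z`, makes
  -- that extension global.
  obtain ⟨f, -, hf⟩ := (SmoothBumpFunction.nhds_basis_tsupport (I := 𝓘(ℝ, E)) z).mem_iff.1
    (interior_mem_nhds.2 hs)
  refine ⟨⟨fun x ↦ f x • FiberBundle.extend E w x, ?_⟩, ?_⟩
  · exact ContMDiffOn.smul_section_of_tsupport f.contMDiff.contMDiffOn isOpen_interior hf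
      (hsw.mono interior_subset)
  · change f z • FiberBundle.extend E w z = w
    simp

theorem VForm.ext_app {K K' : VForm E M} (h : ∀ X, K.app X = K'.app X) : K = K' := by
  ext z : 1
  refine ContinuousLinearMap.ext fun w ↦ ?_
  obtain ⟨X, rfl⟩ := exists_vfield_eq z w
  exact congrArg (fun Y : VField E M ↦ Y z) (h X)

end Extension

/-! ### Linearity of forms and the Lie algebra of vector fields. -/

section Algebra

variable {E : Type*} [NormedAddCommGroup E] [NormedSpace ℝ E]
  {M : Type*} [TopologicalSpace M] [ChartedSpace E M] [IsManifold 𝓘(ℝ, E) ∞ M]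

theorem VForm.app_add (K : VForm E M) (X Y : VField E M) :
    K.app (X + Y) = K.app X + K.app Y := by
  ext z
  exact map_add (K z) (X z) (Y z)

theorem VForm.app_sub (K : VForm E M) (X Y : VField E M) :
    K.app (X - Y) = K.app X - K.app Y := by
  ext z
  exact map_sub (K z) (X z) (Y z)

theorem VForm.app_neg (K : VForm E M) (X : VField E M) : K.app (-X) = -K.app X := by
  ext z
  exact map_neg (K z) (X z)

theorem VForm.app_smul (K : VForm E M) (c : ℝ) (X : VField E M) :
    K.app (c • X) = c • K.app X := by
  ext z
  exact map_smul (K z) c (X z)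

theorem VForm.zero_app (X : VField E M) : (0 : VForm E M).app X = 0 := rfl

variable [FiniteDimensional ℝ E]

theorem bracket_swap (X Y : VField E M) : bracket X Y = -bracket Y X := by
  ext z
  exact mlieBracket_swap_apply

theorem bracket_self (X : VField E M) : bracket X X = 0 := by
  ext z
  exact congrFun (mlieBracket_self (I := 𝓘(ℝ, E)) (V := X)) z

theorem bracket_add_right (X Y Z : VField E M) :
    bracket X (Y + Z) = bracket X Y + bracket X Z := by
  have : CompleteSpace E := FiniteDimensional.complete ℝ E
  ext z
  exact mlieBracket_add_right ((Y.contMDiff z).mdifferentiableAt (by simp))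
    ((Z.contMDiff z).mdifferentiableAt (by simp))

theorem bracket_smul_right (X : VField E M) (c : ℝ) (Y : VField E M) :
    bracket X (c • Y) = c • bracket X Y := by
  have : CompleteSpace E := FiniteDimensional.complete ℝ E
  ext z
  exact mlieBracket_const_smul_right ((Y.contMDiff z).mdifferentiableAt (by simp))

theorem bracket_neg_right (X Y : VField E M) : bracket X (-Y) = -bracket X Y := by
  simpa using bracket_smul_right X (-1) Y

theorem bracket_sub_right (X Y Z : VField E M) :
    bracket X (Y - Z) = bracket X Y - bracket X Z := by
  rw [sub_eq_add_neg, bracket_add_right, bracket_neg_right, sub_eq_add_neg]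

theorem bracket_zero_left (X : VField E M) : bracket 0 X = 0 := by
  have h := bracket_smul_right X 0 0
  rw [zero_smul, zero_smul] at h
  rw [bracket_swap, h, neg_zero]

theorem bracket_jacobi (X Y Z : VField E M) :
    bracket X (bracket Y Z) = bracket (bracket X Y) Z + bracket Y (bracket X Z) := by
  have : CompleteSpace E := FiniteDimensional.complete ℝ E
  have : IsManifold 𝓘(ℝ, E) (minSmoothness ℝ 3) M := by
    rw [minSmoothness_of_isRCLikeNormedField]
    exact .of_le (n := ∞) ENat.LEInfty.out
  have h2 : minSmoothness ℝ 2 ≤ ∞ := by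
    rw [minSmoothness_of_isRCLikeNormedField]
    exact ENat.LEInfty.out
  ext z
  exact leibniz_identity_mlieBracket_apply ((X.contMDiff z).of_le h2) ((Y.contMDiff z).of_le h2)
    ((Z.contMDiff z).of_le h2)

end Algebra

/-! ### The identity `[L, C] = L` in adapted coordinates. -/

section Coordinates

variable {E : Type*} [NormedAddCommGroup E] [NormedSpace ℝ E]
  {M : Type*} [TopologicalSpace M] [ChartedSpace E M] {m : ℕ}

/-- The vector field on the domain of a coordinate system with constant components `v`. -/
def coordField (e : OpenPartialHomeomorph M ((Fin m → ℝ) × (Fin m → ℝ)))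
    (v : (Fin m → ℝ) × (Fin m → ℝ)) (p : M) : TangentSpace 𝓘(ℝ, E) p :=
  mpullback 𝓘(ℝ, E) 𝓘(ℝ, (Fin m → ℝ) × (Fin m → ℝ)) e (fun _ ↦ v) p

/-- The inverse of the derivative of a coordinate system at `p`. -/
def coordInv (e : OpenPartialHomeomorph M ((Fin m → ℝ) × (Fin m → ℝ))) (p : M) :
    ((Fin m → ℝ) × (Fin m → ℝ)) →L[ℝ] TangentSpace 𝓘(ℝ, E) p :=
  (mfderiv 𝓘(ℝ, E) 𝓘(ℝ, (Fin m → ℝ) × (Fin m → ℝ)) e p).inverse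

theorem pair_eq_sum (a b : Fin m → ℝ) :
    ((a, b) : (Fin m → ℝ) × (Fin m → ℝ)) =
      ∑ i, a i • ((Pi.single i 1, 0) : (Fin m → ℝ) × (Fin m → ℝ)) +
        ∑ i, b i • ((0, Pi.single i 1) : (Fin m → ℝ) × (Fin m → ℝ)) := by
  ext j <;> simp [Prod.fst_sum, Prod.snd_sum, Finset.sum_apply, Pi.single_apply]

theorem coordInv_pair (e : OpenPartialHomeomorph M ((Fin m → ℝ) × (Fin m → ℝ))) (p : M)
    (a b : Fin m → ℝ) :
    coordInv (E := E) e p (a, b) = ∑ i, a i • coordX e i p + ∑ i, b i • coordY e i p := by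
  rw [pair_eq_sum, map_add, map_sum, map_sum]
  simp only [map_smul]
  rfl

/-- Rules out the junk value of `inverse`: the pulled-back constant fields are smooth and fill each
tangent space. -/
theorem isInvertible_mfderiv {e : OpenPartialHomeomorph M ((Fin m → ℝ) × (Fin m → ℝ))}
    (he : ContMDiffOn 𝓘(ℝ, E) 𝓘(ℝ, (Fin m → ℝ) × (Fin m → ℝ)) ∞ e e.source)
    (he' : ContMDiffOn 𝓘(ℝ, (Fin m → ℝ) × (Fin m → ℝ)) 𝓘(ℝ, E) ∞ e.symm e.target)
    {p : M} (hp : p ∈ e.source) :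
    (mfderiv 𝓘(ℝ, E) 𝓘(ℝ, (Fin m → ℝ) × (Fin m → ℝ)) e p).IsInvertible := by
  have hmd : e.MDifferentiable 𝓘(ℝ, E) 𝓘(ℝ, (Fin m → ℝ) × (Fin m → ℝ)) :=
    ⟨he.mdifferentiableOn (by simp), he'.mdifferentiableOn (by simp)⟩
  exact ⟨hmd.mfderiv hp, rfl⟩

variable [IsManifold 𝓘(ℝ, E) ∞ M]

theorem form_coordInv {e : OpenPartialHomeomorph M ((Fin m → ℝ) × (Fin m → ℝ))} {p : M}
    {L : VForm E M} (hX : ∀ i, L p (coordX e i p) = coordY e i p)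
    (hY : ∀ i, L p (coordY e i p) = 0) (a b : Fin m → ℝ) :
    L p (coordInv e p (a, b)) = coordInv e p (0, a) := by
  simp only [coordInv_pair, map_add, map_sum, map_smul, hX, hY]
  simp

theorem mdifferentiableAt_tangent_of_contDiff {F : Type*} [NormedAddCommGroup F] [NormedSpace ℝ F]
    {V : F → F} (hV : ContDiff ℝ ∞ V) (q : F) :
    MDifferentiableAt 𝓘(ℝ, F) 𝓘(ℝ, F).tangent
      (fun x ↦ (⟨x, V x⟩ : TangentBundle 𝓘(ℝ, F) F)) q :=
  (contMDiffAt_vectorSpace_iff_contDiffAt.2 hV.contDiffAt).mdifferentiableAt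
    (n := ∞) (by simp)

variable [FiniteDimensional ℝ E]

/-- In a coordinate system, the bracket of a field with constant components `(a, b)` with the field
`∑ yⁱ ∂/∂yⁱ` has constant components `(0, b)`. -/
theorem mlieBracket_coordField {e : OpenPartialHomeomorph M ((Fin m → ℝ) × (Fin m → ℝ))}
    (he : ContMDiffOn 𝓘(ℝ, E) 𝓘(ℝ, (Fin m → ℝ) × (Fin m → ℝ)) ∞ e e.source)
    {p : M} (hp : p ∈ e.source) (a b : Fin m → ℝ) :
    mlieBracket 𝓘(ℝ, E) (coordField e (a, b))
      (mpullback 𝓘(ℝ, E) 𝓘(ℝ, (Fin m → ℝ) × (Fin m → ℝ)) e (fun q ↦ (0, q.2))) p =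
    coordInv e p (0, b) := by
  have : CompleteSpace E := FiniteDimensional.complete ℝ E
  have : IsManifold 𝓘(ℝ, E) (minSmoothness ℝ 2) M := by
    rw [minSmoothness_of_isRCLikeNormedField]; infer_instance
  have h2 : minSmoothness ℝ 2 ≤ ∞ := by
    rw [minSmoothness_of_isRCLikeNormedField]
    exact ENat.LEInfty.out
  let Y : ((Fin m → ℝ) × (Fin m → ℝ)) →L[ℝ] ((Fin m → ℝ) × (Fin m → ℝ)) :=
    (ContinuousLinearMap.inr ℝ _ _).comp (ContinuousLinearMap.snd ℝ _ _)
  have h := mpullback_mlieBracket (I := 𝓘(ℝ, E)) (n := ∞)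
    (mdifferentiableAt_tangent_of_contDiff (contDiff_const (c := (a, b))) (e p))
    (mdifferentiableAt_tangent_of_contDiff Y.contDiff (e p))
    (he.contMDiffAt (e.open_source.mem_nhds hp)) h2
  refine h.symm.trans ?_
  -- The first field is constant and `Y` is linear, so the bracket is `Y` applied to `(a, b)`.
  have hb : mlieBracket 𝓘(ℝ, (Fin m → ℝ) × (Fin m → ℝ)) (fun _ ↦ (a, b)) Y (e p) = (0, b) := by
    refine (congrFun (mlieBracketWithin_eq_lieBracketWithin (V := fun _ ↦ (a, b)) (W := Y)) _).trans
      ?_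
    rw [lieBracketWithin_univ]
    simp [lieBracket, Y]
    rfl
  rw [mpullback_apply, hb]
  rfl

/-- A canonical vector field `C` of `L` satisfies `[L, C] = L`. -/
theorem IsCanonicalField.fnBracket_eq {L : VForm E M} {C : VField E M}
    (hC : IsCanonicalField m L C) : fnBracket L C = L := by
  have : CompleteSpace E := FiniteDimensional.complete ℝ E
  ext z : 1
  obtain ⟨e, hz, he, he', h⟩ := hC z
  have hsrc : ∀ᶠ p in 𝓝 z, p ∈ e.source := e.open_source.mem_nhds hz
  have hinv := isInvertible_mfderiv he he' hz
  have hLp : ∀ p ∈ e.source, ∀ a b, L p (coordInv e p (a, b)) = coordInv e p (0, a) :=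
    fun p hp ↦ form_coordInv (h p hp).1 (h p hp).2.1
  have hCe : (C : Π p : M, TangentSpace 𝓘(ℝ, E) p) =ᶠ[𝓝 z]
      mpullback 𝓘(ℝ, E) 𝓘(ℝ, (Fin m → ℝ) × (Fin m → ℝ)) e (fun q ↦ (0, q.2)) := by
    filter_upwards [hsrc] with p hp
    rw [(h p hp).2.2]
    change _ = coordInv e p (0, (e p).2)
    simp [coordInv_pair]
  refine ContinuousLinearMap.ext fun w ↦ ?_
  -- By tensoriality, `w` may be extended by the field with constant components `(a, b)`; then `[L,
  -- C]` sends it to `(0, a) - L (0, b) = (0, a)`, as `L` does.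
  obtain ⟨⟨a, b⟩, rfl⟩ : ∃ v, coordInv e z v = w := by
    obtain ⟨A, hA⟩ := hinv
    refine ⟨A w, ?_⟩
    rw [coordInv, ← hA, ContinuousLinearMap.inverse_equiv]
    exact A.symm_apply_apply w
  have hdiff : MDifferentiableAt 𝓘(ℝ, E) 𝓘(ℝ, E).tangent
      (fun x ↦ (⟨x, coordField e (a, b) x⟩ : TangentBundle 𝓘(ℝ, E) M)) z :=
    MDifferentiableAt.mpullback_vectorField (n := ∞)
      (mdifferentiableAt_tangent_of_contDiff (contDiff_const (c := (a, b))) (e z))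
      (he.contMDiffAt (e.open_source.mem_nhds hz)) hinv ENat.LEInfty.out
  have hLe : (fun x ↦ L x (coordField e (a, b) x)) =ᶠ[𝓝 z] coordField e (0, a) := by
    filter_upwards [hsrc] with p hp using hLp p hp a b
  refine (TensorialAt.mkHom_apply (tensorialAt_preBracket L C z) hdiff).trans ?_
  rw [preBracket, hLe.mlieBracket_vectorField_eq hCe,
    Filter.EventuallyEq.rfl.mlieBracket_vectorField_eq hCe, mlieBracket_coordField he hz,
    mlieBracket_coordField he hz, hLp z hz, hLp z hz]
  simp [coordInv_pair]

end Coordinates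

end LConn

end

namespace LConn

/-! ### The connection `[L, S]` and its canonical semispray. -/

section Connection

variable {E : Type*} [NormedAddCommGroup E] [NormedSpace ℝ E]
  {M : Type*} [TopologicalSpace M] [ChartedSpace E M] [IsManifold 𝓘(ℝ, E) ∞ M]
  {L Γ : VForm E M} {C S : VField E M}

theorem VForm.app_app_eq_zero
    (himker : ∀ z, LinearMap.range (L z).toLinearMap = LinearMap.ker (L z).toLinearMap)
    (X : VField E M) : L.app (L.app X) = 0 := by
  ext z
  have h : L z (X z) ∈ LinearMap.range (L z).toLinearMap := ⟨X z, rfl⟩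
  rw [himker z] at h
  exact h

/-- A connection acts by `-1` on the vector fields annihilated by `L`. -/
theorem IsConnection.app_of_app_eq_zero
    (himker : ∀ z, LinearMap.range (L z).toLinearMap = LinearMap.ker (L z).toLinearMap)
    (hΓ : IsConnection L Γ) {V : VField E M} (hV : L.app V = 0) : Γ.app V = -V := by
  ext z
  have h : V z ∈ LinearMap.ker (L z).toLinearMap :=
    congrArg (fun X : VField E M ↦ X z) hV
  rw [← himker z] at h
  obtain ⟨w, hw⟩ := h
  have := congrArg (fun A : TangentSpace 𝓘(ℝ, E) z →L[ℝ] TangentSpace 𝓘(ℝ, E) z ↦ A w) (hΓ.2 z)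
  change Γ z (L z w) = -(L z w) at this
  change L z w = V z at hw
  rw [hw] at this
  exact this

variable [FiniteDimensional ℝ E]

/-- This is `[C, L] = -L`, the form in which the canonical field is used from here on. -/
theorem bracket_canonical_app (hLC : fnBracket L C = L) (X : VField E M) :
    bracket C (L.app X) = L.app (bracket C X) - L.app X := by
  have h := fnBracket_app L C X
  rw [hLC, bracket_swap _ C, bracket_swap X C, VForm.app_neg] at h
  calc bracket C (L.app X)
      = L.app (bracket C X) - (-bracket C (L.app X) - -L.app (bracket C X)) := by abel
    _ = L.app (bracket C X) - L.app X := by rw [← h]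

theorem IsSemispray.bracket_canonical (hLC : fnBracket L C = L) (hS : IsSemispray L C S) :
    IsSemispray L C (bracket C S) := by
  have h := bracket_canonical_app hLC S
  rw [IsSemispray] at hS ⊢
  rw [hS, bracket_self] at h
  exact (sub_eq_zero.1 h.symm)

/-- In `N_L(X, S) = 0` the `L²` term drops out, and the two terms containing `L S = C` combine to
`[L, C] X = L X`. -/
theorem IsSemispray.app_bracket_app
    (hnij : ∀ X Y, nijenhuis L X Y = 0)
    (himker : ∀ z, LinearMap.range (L z).toLinearMap = LinearMap.ker (L z).toLinearMap)
    (hLC : fnBracket L C = L) (hS : IsSemispray L C S) (X : VField E M) :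
    L.app (bracket (L.app X) S) = L.app X := by
  have h := hnij X S
  have h' := fnBracket_app L C X
  rw [hLC] at h'
  rw [nijenhuis, hS, VForm.app_app_eq_zero himker, add_zero, sub_right_comm, ← h',
    sub_eq_zero] at h
  exact h.symm

theorem IsSemispray.fnBracket_app_self (hS : IsSemispray L C S) :
    (fnBracket L S).app S = bracket C S := by
  have h0 : L.app (0 : VField E M) = 0 := by
    simpa using L.app_smul 0 0
  rw [fnBracket_app, hS, bracket_self, h0, sub_zero]

/-- `[C, Γ]` annihilates the vector fields annihilated by `L`, for every connection `Γ`. -/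
theorem IsConnection.fieldFormBracket_app_eq_zero
    (himker : ∀ z, LinearMap.range (L z).toLinearMap = LinearMap.ker (L z).toLinearMap)
    (hLC : fnBracket L C = L) (hΓ : IsConnection L Γ) {V : VField E M} (hV : L.app V = 0) :
    (fieldFormBracket C Γ).app V = 0 := by
  -- Bracketing with `C` preserves `Ker L`, where `Γ` is `-1` and so commutes with it.
  have h : L.app (bracket C V) = 0 := by
    have h := bracket_canonical_app hLC V
    have h0 : bracket C 0 = 0 := by rw [bracket_swap, bracket_zero_left, neg_zero]
    rw [hV, h0, sub_zero] at h
    exact h.symm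
  rw [fieldFormBracket_app, hΓ.app_of_app_eq_zero himker hV, hΓ.app_of_app_eq_zero himker h,
    bracket_neg_right, sub_self]

variable [T2Space M]

theorem IsSemispray.isConnection_fnBracket
    (hnij : ∀ X Y, nijenhuis L X Y = 0)
    (himker : ∀ z, LinearMap.range (L z).toLinearMap = LinearMap.ker (L z).toLinearMap)
    (hLC : fnBracket L C = L) (hS : IsSemispray L C S) :
    IsConnection L (fnBracket L S) := by
  have hsq := VForm.app_app_eq_zero himker
  have hL := hS.app_bracket_app hnij himker hLC
  constructor
  · refine fun z ↦ ContinuousLinearMap.ext fun w ↦ ?_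
    obtain ⟨X, rfl⟩ := exists_vfield_eq z w
    have h : L.app ((fnBracket L S).app X) = L.app X := by
      rw [fnBracket_app, VForm.app_sub, hsq, sub_zero, hL]
    exact congrArg (fun Y : VField E M ↦ Y z) h
  · refine fun z ↦ ContinuousLinearMap.ext fun w ↦ ?_
    obtain ⟨X, rfl⟩ := exists_vfield_eq z w
    have h : (fnBracket L S).app (L.app X) = -L.app X := by
      rw [fnBracket_app, hsq, bracket_zero_left, hL, zero_sub]
    exact congrArg (fun Y : VField E M ↦ Y z) h

/-- Testing `T = h S'` on `S' = S` already determines `T`; conversely, neither condition depends on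
`S'`, because `S' - S` lies in `Ker L`. -/
theorem IsSemispray.isCanonicalSemispray_iff
    (hnij : ∀ X Y, nijenhuis L X Y = 0)
    (himker : ∀ z, LinearMap.range (L z).toLinearMap = LinearMap.ker (L z).toLinearMap)
    (hLC : fnBracket L C = L) (hS : IsSemispray L C S) (T : VField E M) :
    IsCanonicalSemispray L C (fnBracket L S) T ↔ T = (1 / 2 : ℝ) • (S + bracket C S) := by
  have hΓ := hS.isConnection_fnBracket hnij himker hLC
  have hCS := hS.bracket_canonical hLC
  have hΓS := hS.fnBracket_app_self
  have hver {S' : VField E M} (hS' : IsSemispray L C S') : L.app (S' - S) = 0 := by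
    rw [VForm.app_sub, hS', hS, sub_self]
  have hΓS' {S' : VField E M} (hS' : IsSemispray L C S') :
      (fnBracket L S).app S' = bracket C S - (S' - S) := by
    have h := hΓ.app_of_app_eq_zero himker (hver hS')
    rw [VForm.app_sub, hΓS] at h
    rw [sub_eq_iff_eq_add.1 h]
    abel
  refine ⟨fun hT ↦ ?_, ?_⟩
  · rw [(hT.2 S hS).1, horizontal, hΓS]
  · rintro rfl
    refine ⟨?_, fun S' hS' ↦ ⟨?_, ?_⟩⟩
    · rw [IsSemispray] at hS hCS ⊢
      rw [VForm.app_smul, VForm.app_add, hS, hCS]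
      module
    · rw [horizontal, hΓS' hS']
      congr 1
      abel
    · have h : (fieldFormBracket C (fnBracket L S)).app S' =
          bracket C (bracket C S) - S := by
        have h0 := hΓ.fieldFormBracket_app_eq_zero himker hLC (hver hS')
        rw [VForm.app_sub, sub_eq_zero] at h0
        -- Since `[C, S]` is itself a semispray, `Γ [C, S] = [C, S] - ([C, S] - S) = S`.
        rw [h0, fieldFormBracket_app, hΓS, hΓS' hCS]
        abel
      rw [h, bracket_smul_right, bracket_add_right]
      module

/-- By Jacobi, `[C, [L, S]] = [[C, L], S] + [L, [C, S]] = -[L, S] + [L, S]`; the proof carries this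
out on each field `X`. -/
theorem fieldFormBracket_fnBracket_eq_zero (hLC : fnBracket L C = L) (hS : bracket C S = S) :
    fieldFormBracket C (fnBracket L S) = 0 := by
  refine VForm.ext_app fun X ↦ ?_
  have h1 := bracket_jacobi C (L.app X) S
  have h2 := bracket_jacobi C X S
  have hsub : bracket (L.app (bracket C X) - L.app X) S =
      bracket (L.app (bracket C X)) S - bracket (L.app X) S := by
    rw [bracket_swap, bracket_sub_right, bracket_swap _ S, bracket_swap _ S]
    abel
  rw [hS, bracket_canonical_app hLC, hsub] at h1
  rw [hS] at h2
  rw [fieldFormBracket_app, fnBracket_app, fnBracket_app, bracket_sub_right, h1,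
    bracket_canonical_app hLC, h2, VForm.app_add, VForm.zero_app]
  abel

end Connection

end LConn

theorem theorem2
    {E : Type*} [NormedAddCommGroup E] [NormedSpace ℝ E] [FiniteDimensional ℝ E]
    {M : Type*} [TopologicalSpace M] [ChartedSpace E M] [IsManifold 𝓘(ℝ, E) ∞ M]
    [T2Space M] [ParacompactSpace M]
    (m : ℕ) (hm : 1 ≤ m) (L : LConn.VForm E M)
    (hrank : ∀ z, Module.finrank ℝ (LinearMap.range (L z).toLinearMap) = m)
    (hnij : ∀ X Y, LConn.nijenhuis L X Y = 0)
    (himker : ∀ z, LinearMap.range (L z).toLinearMap = LinearMap.ker (L z).toLinearMap)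
    (C : LConn.VField E M) (hC : LConn.IsCanonicalField m L C) :
    (∀ S : LConn.VField E M, LConn.IsSemispray L C S →
      LConn.IsConnection L (LConn.fnBracket L S) ∧
      ∀ S' : LConn.VField E M, LConn.IsCanonicalSemispray L C (LConn.fnBracket L S) S' ↔
        S' = (1 / 2 : ℝ) • (S + LConn.bracket C S)) ∧
    (∀ S : LConn.VField E M, LConn.IsSpray L C S →
      LConn.IsHomogeneousConnection L C (LConn.fnBracket L S) ∧
      ∀ S' : LConn.VField E M, LConn.IsCanonicalSemispray L C (LConn.fnBracket L S) S' ↔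
        S' = S) := by
  have hLC := hC.fnBracket_eq
  refine ⟨fun S hS ↦ ⟨hS.isConnection_fnBracket hnij himker hLC,
    hS.isCanonicalSemispray_iff hnij himker hLC⟩, fun S hS ↦ ?_⟩
  have hCS : LConn.bracket C S = S := by
    have h : LConn.bracket C S = ((2 : ℝ) - 1) • S := hS.2
    rw [h]
    module
  refine ⟨⟨hS.1.isConnection_fnBracket hnij himker hLC, ?_⟩, fun S' ↦ ?_⟩
  · rw [LConn.IsHomogeneousForm, LConn.fieldFormBracket_fnBracket_eq_zero hLC hCS, sub_self]
    exact (zero_smul ℝ (LConn.fnBracket L S)).symm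
  · have hS2 : (1 / 2 : ℝ) • (S + S) = S := by module
    rw [hS.1.isCanonicalSemispray_iff hnij himker hLC, hCS, hS2]
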